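/- Let $X$ be a complete metric space and $S(t)$, $t\ge 0$, a semiflow on $X$, i.e. $S(0)=\mathrm{id}$, $S(t+s)=S(t)S(s)$, with $(t,x)\mapsto S(t)x$ continuous. Assume that $S$ is asymptotically compact: if $x_n$ is a bounded sequence, $t_n\to+\infty$ and $S(t_n)x_n$ is bounded, then $S(t_n)x_n$ has a convergent subsequence. An attractor is a compact set $A$ with $S(t)A=A$ for all $t\ge 0$ that attracts a neighborhood of itself (every $\varepsilon$-neighborhood of $A$ contains the image of that neighborhood under $S(t)$ for all large $t$); its attraction basin is $\Omega(A)=\{x: d(S(t)x,A)\to 0 \text{ as } t\to\infty\}$, with $\Omega(\emptyset)=\emptyset$. Let $\mathscr A$ be an attractor of $S$ with basin $\Omega=\Omega(\mathscr A)$, let $\emptyset=A_0\subsetneq A_1\subsetneq\cdots\subsetneq A_l=\mathscr A$ be attractors of the restriction of $S$ to $\mathscr A$, and let $M_k=\{x\in A_k : \omega(x)\cap A_{k-1}=\emptyset\}$, $1\le k\le l$, be the Morse sets of the corresponding Morse decomposition. Let $V:\Omega\to\mathbb R$ be a strict Morse–Lyapunov function: $V$ is continuous, it is constant on each $M_k$,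 $V(S(t)x)<V(x)$ for all $t>0$ and all $x\in\Omega$ outside $\bigcup_j M_j$, and $V(M_1)<V(M_2)<\cdots<V(M_l)$. Write $V_r=\{x\in\Omega: V(x)\le r\}$, and let $H_*$ be relative singular homology with coefficients in an arbitrary abelian group. Fix $1\le k\le l$ and let $a<V(M_k)<b$ be such that $V(M_k)$ is the only one of the values $V(M_1),\dots,V(M_l)$ in $[a,b]$. The critical groups of $M_k$ are $C_q(M_k)=H_q(V_b,V_a)$, $q=0,1,2,\dots$ Let $W_k\subset\Omega(A_k)$ and $W_{k-1}\subset\Omega(A_{k-1})$ be any positively invariant neighborhoods of $A_k$ and $A_{k-1}$, respectively, with $W_{k-1}\subset W_k$. Then $$C_q(M_k)\cong H_q(W_k,W_{k-1}),\qquad q=0,1,2,\dots$$ -/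

import Mathlib

open CategoryTheory Set Filter Topology
open scoped NNReal

universe u v

/-! ### Relative singular homology -/

/-- The inclusion of `A` into `B`, as a morphism of topological spaces. -/
def inclusionTop {X : Type u} [TopologicalSpace X] {A B : Set X} (h : A ⊆ B) :
    TopCat.of A ⟶ TopCat.of B :=
  TopCat.ofHom ⟨Set.inclusion h, continuous_inclusion h⟩

/-- The relative singular chain complex `C_*(B, A; G) = C_*(B; G) / C_*(A; G)`. -/
noncomputable def relativeSingularChainComplex {X : Type u} [TopologicalSpace X]
    (G : Type v) [AddCommGroup G] {A B : Set X} (h : A ⊆ B) :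
    ChainComplex AddCommGrpCat.{max u v} ℕ :=
  Limits.cokernel
    (((AlgebraicTopology.singularChainComplexFunctor AddCommGrpCat.{max u v}).obj
      (AddCommGrpCat.of (ULift.{u} G))).map (inclusionTop h))

/-- The relative singular homology group `H_q(B, A; G)` of a pair `A ⊆ B` of subspaces of `X`. -/
noncomputable def relativeSingularHomology {X : Type u} [TopologicalSpace X]
    (G : Type v) [AddCommGroup G] {A B : Set X} (h : A ⊆ B) (q : ℕ) :
    AddCommGrpCat.{max u v} :=
  (relativeSingularChainComplex G h).homology q

/-! ### Semiflows and attractors -/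

/-- A semiflow on `X`: a continuous map `S : [0, ∞) × X → X` with `S 0 = id` and
`S (t + s) = S t ∘ S s`. -/
abbrev Semiflow (X : Type*) [TopologicalSpace X] := Flow ℝ≥0 X

namespace Semiflow

section Metric

variable {X : Type*} [MetricSpace X]

/-- Asymptotic compactness: if `x n` is bounded, `t n → ∞` and `S (t n) (x n)` is bounded, then
`S (t n) (x n)` has a convergent subsequence. -/
def AsymptoticallyCompact (S : Semiflow X) : Prop :=
  ∀ (x : ℕ → X) (t : ℕ → ℝ≥0), Bornology.IsBounded (range x) → Tendsto t atTop atTop →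
    Bornology.IsBounded (range fun n => S (t n) (x n)) →
    ∃ (y : X) (φ : ℕ → ℕ), StrictMono φ ∧
      Tendsto (fun n => S (t (φ n)) (x (φ n))) atTop (𝓝 y)

/-- `A` attracts `B`: every `ε`-neighbourhood of `A` contains `S t B` for all large `t`. -/
def Attracts (S : Semiflow X) (A B : Set X) : Prop :=
  ∀ ε : ℝ, 0 < ε → ∃ T : ℝ≥0, ∀ t, T < t → S t '' B ⊆ Metric.thickening ε A

/-- The attraction basin of `A`, the set of `x` with `d(S t x, A) → 0` as `t → ∞`. The distance is
extended-valued, with `d(y, ∅) = ∞`, so the basin of `∅` is `∅`. -/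
def basin (S : Semiflow X) (A : Set X) : Set X :=
  {x | Tendsto (fun t : ℝ≥0 => Metric.infEDist (S t x) A) atTop (𝓝 0)}

/-- An attractor: a compact set `A` with `S t A = A` for all `t` that attracts a neighbourhood of
itself. -/
structure IsAttractor (S : Semiflow X) (A : Set X) : Prop where
  isCompact : IsCompact A
  image_eq : ∀ t, S t '' A = A
  attracts : ∃ U ∈ 𝓝ˢ A, S.Attracts A U

/-- `A` is an attractor of `S` in the invariant set `K`: it is a subset of `K` and an attractor of
the restriction of `S` to `K`. -/
def IsAttractorIn (S : Semiflow X) (K A : Set X) : Prop :=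
  A ⊆ K ∧ ∃ hK : IsInvariant S K,
    IsAttractor (Flow.restrict S hK) (Subtype.val ⁻¹' A : Set K)

/-- The repeller in `K` dual to `A`: the points of `K` whose `ω`-limit set does not meet `A`. -/
def dualRepeller (S : Semiflow X) (K A : Set X) : Set X :=
  {x ∈ K | omegaLimit atTop S {x} ∩ A = ∅}

/-! ### Morse decompositions -/

/-- A Morse filtration `∅ = A₀ ⊊ A₁ ⊊ ⋯ ⊊ A_l = K` of attractors of `S` in `K`. -/
structure IsMorseFiltration (S : Semiflow X) (K : Set X) {l : ℕ} (A : Fin (l + 1) → Set X) :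
    Prop where
  zero : A 0 = ∅
  last : A (Fin.last l) = K
  strictMono : StrictMono A
  isAttractorIn : ∀ k, S.IsAttractorIn K (A k)

/-- The Morse sets `M_k = A_k ∩ A_{k-1}^*` of a Morse filtration, `1 ≤ k ≤ l`; the set `M_k` has
index `k - 1` in `Fin l`. -/
def morseSet (S : Semiflow X) (K : Set X) {l : ℕ} (A : Fin (l + 1) → Set X) (k : Fin l) : Set X :=
  A k.succ ∩ S.dualRepeller K (A k.castSucc)

/-! ### Morse-Lyapunov functions -/

/-- `V` (of which only the values on the basin `Ω` of the attractor `K` matter) is a Morse-Lyapunov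
function on `Ω` of the family `M` of Morse sets: `V` is continuous on `Ω`, constant on each Morse
set, and strictly decreasing along trajectories outside the Morse sets. A trajectory of a semiflow
may enter a Morse set in finite time, after which `V` is constant along it; so strict decrease is
required exactly from the points that lie in no Morse set. -/
structure IsMorseLyapunov (S : Semiflow X) (K : Set X) {l : ℕ} (M : Fin l → Set X) (V : X → ℝ) :
    Prop where
  continuousOn : ContinuousOn V (S.basin K)
  const : ∀ k, ∀ x ∈ M k, ∀ y ∈ M k, V x = V y
  strictAnti : ∀ x ∈ S.basin K \ ⋃ k, M k, ∀ t, 0 < t → V (S t x) < V x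

/-- A strict Morse-Lyapunov function: moreover `V(M₁) < V(M₂) < ⋯ < V(M_l)`. -/
structure IsStrictMorseLyapunov (S : Semiflow X) (K : Set X) {l : ℕ} (M : Fin l → Set X)
    (V : X → ℝ) : Prop extends S.IsMorseLyapunov K M V where
  lt : ∀ i j, i < j → ∀ x ∈ M i, ∀ y ∈ M j, V x < V y

/-- The value `c = V(M_k)` satisfies `a < c < b` and is the only generalized critical value (value
of `V` on a Morse set) in `[a, b]`. -/
def IsolatesCriticalValue {l : ℕ} (M : Fin l → Set X) (V : X → ℝ) (k : Fin l) (a b : ℝ) : Prop :=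
  ∃ c, V '' M k = {c} ∧ a < c ∧ c < b ∧ (⋃ j, V '' M j) ∩ Icc a b = {c}

/-- The level set `V_a = {x ∈ Ω | V x ≤ a}` in the basin `Ω` of `K`. -/
def sublevel (S : Semiflow X) (K : Set X) (V : X → ℝ) (a : ℝ) : Set X :=
  {x ∈ S.basin K | V x ≤ a}

theorem sublevel_mono (S : Semiflow X) (K : Set X) (V : X → ℝ) {a b : ℝ} (hab : a ≤ b) :
    S.sublevel K V a ⊆ S.sublevel K V b :=
  fun _ hx => ⟨hx.1, hx.2.trans hab⟩

end Metric

/-- The critical group `C_q(M_k) = H_q(V_b, V_a; G)` of the Morse set whose generalized critical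
value is isolated by `[a, b]`, computed from the strict Morse-Lyapunov function `V` and the
numbers `a < b`. -/
noncomputable def criticalGroup {X : Type u} [MetricSpace X] (S : Semiflow X) (K : Set X)
    (G : Type v) [AddCommGroup G] (V : X → ℝ) {a b : ℝ} (hab : a < b) (q : ℕ) :
    AddCommGrpCat.{max u v} :=
  relativeSingularHomology G (S.sublevel_mono K V hab.le) q

end Semiflow

/-! Both pairs include into the pair of basins `(Ω(A_k), Ω(A_{k-1}))`, and both inclusions are
isomorphisms on homology, so neither the choice of neighbourhoods nor `V` matters.

A positively invariant neighbourhood `W` of a compact `A` inside its basin absorbs each compact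
subset of the basin after some time. Singular chains have compact support and the time-`t` map is
homotopic to the identity, so `W` and the basin have the same homology (`quasiIso_inclusion`); the
five lemma passes this to pairs (`nonempty_relativeSingularHomology_iso_basin`).

It remains to see that `(V_b, V_a)` is such a pair. Limit points of orbits lie in Morse sets, which
bounds the sublevel sets by the basins (`sublevel_subset_basin`); the maximum of `V` on an attractor
is taken on a Morse set inside it, which makes them neighbourhoods (`sublevel_mem_nhdsSet`). -/

open Limits AlgebraicTopology

/-! ### Homological algebra of complexes of abelian groups. -/

/-- The elements of a coproduct of abelian groups are generated by the summands. -/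
theorem AddCommGrpCat.cofan_induction {ι : Type u} {F : ι → AddCommGrpCat.{v}} {c : Cofan F}
    (hc : IsColimit c) (H : AddSubgroup c.pt) (h : ∀ i (g : F i), c.inj i g ∈ H) (x : c.pt) :
    x ∈ H := by
  have hq : AddCommGrpCat.ofHom (QuotientAddGroup.mk' H) = 0 := by
    refine Cofan.IsColimit.hom_ext hc _ _ fun i => ?_
    ext g
    exact (QuotientAddGroup.eq_zero_iff _).2 (h i g)
  have := ConcreteCategory.congr_hom hq x
  exact (QuotientAddGroup.eq_zero_iff _).1 this

/-- A monomorphism of complexes of abelian groups is a quasi-isomorphism if every chain of the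
target can be deformed into the source. -/
theorem AddCommGrpCat.quasiIso_of_deformation {C D : ChainComplex AddCommGrpCat.{v} ℕ}
    (f : C ⟶ D) [Mono f]
    (h : ∀ (q : ℕ) (d : D.X q), ∃ (φ : C ⟶ C) (ψ : D ⟶ D), Nonempty (Homotopy φ (𝟙 C)) ∧
      Nonempty (Homotopy ψ (𝟙 D)) ∧ φ ≫ f = f ≫ ψ ∧ ∃ c : C.X q, f.f q c = ψ.f q d) :
    QuasiIso f := by
  have hinj : ∀ q, Function.Injective (f.f q) := fun q =>
    (AddCommGrpCat.mono_iff_injective _).1 inferInstance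
  rw [quasiIso_iff]
  intro q
  rw [quasiIsoAt_iff_isIso_homologyMap]
  have hπs : ∀ (E : ChainComplex AddCommGrpCat.{v} ℕ), Function.Surjective (E.homologyπ q) :=
    fun E => (AddCommGrpCat.epi_iff_surjective _).1 inferInstance
  have hi : ∀ (E : ChainComplex AddCommGrpCat.{v} ℕ), Function.Injective (E.iCycles q) :=
    fun E => (AddCommGrpCat.mono_iff_injective _).1 inferInstance
  have hid : ∀ (E : ChainComplex AddCommGrpCat.{v} ℕ) (z : E.cycles q),
      E.d q (q - 1) (E.iCycles q z) = 0 := by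
    intro E z
    have := ConcreteCategory.congr_hom (E.iCycles_d q (q - 1)) z
    exact this
  have hcyc : ∀ (E : ChainComplex AddCommGrpCat.{v} ℕ) (x : E.X q),
      E.d q (q - 1) x = 0 → ∃ z : E.cycles q, E.iCycles q z = x := by
    intro E x hx
    exact (ShortComplex.ab_exact_iff _).1 (ShortComplex.exact_of_f_is_kernel
      (ShortComplex.mk _ _ (E.iCycles_d q (q - 1))) (E.cyclesIsKernel q (q - 1) (by cases q <;> simp))) x hx
  have hbd : ∀ (E : ChainComplex AddCommGrpCat.{v} ℕ) (z : E.cycles q), E.homologyπ q z = 0 ↔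
      ∃ w : E.X (q + 1), E.d (q + 1) q w = E.iCycles q z := by
    intro E z
    have hto : ∀ w, E.iCycles q (E.toCycles (q + 1) q w) = E.d (q + 1) q w :=
      fun w => ConcreteCategory.congr_hom (E.toCycles_i (q + 1) q) w
    constructor
    · intro hz
      obtain ⟨w, hw⟩ := (ShortComplex.ab_exact_iff _).1 (ShortComplex.exact_of_g_is_cokernel
        (ShortComplex.mk _ _ (E.toCycles_comp_homologyπ (q + 1) q))
        (E.homologyIsCokernel (q + 1) q (by simp))) z hz
      exact ⟨w, by rw [← hto]; exact congrArg _ hw⟩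
    · rintro ⟨w, hw⟩
      obtain rfl : E.toCycles (q + 1) q w = z := hi E (by rw [hto, hw])
      exact ConcreteCategory.congr_hom (E.toCycles_comp_homologyπ (q + 1) q) w
  have hmap : ∀ {E E' : ChainComplex AddCommGrpCat.{v} ℕ} (g : E ⟶ E')
      (z : E.cycles q) (z' : E'.cycles q),
      g.f q (E.iCycles q z) = E'.iCycles q z' →
      HomologicalComplex.homologyMap g q (E.homologyπ q z) = E'.homologyπ q z' := by
    intro E E' g z z' hz
    have h1 := ConcreteCategory.congr_hom (HomologicalComplex.homologyπ_naturality g q) z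
    have h2 := ConcreteCategory.congr_hom (HomologicalComplex.cyclesMap_i g q) z
    simp only [ConcreteCategory.comp_apply] at h1 h2
    rw [h1]
    congr 1
    apply hi
    rw [h2, hz]
  have hone : ∀ {E : ChainComplex AddCommGrpCat.{v} ℕ} {g : E ⟶ E}, Nonempty (Homotopy g (𝟙 E)) →
      ∀ (z z' : E.cycles q), g.f q (E.iCycles q z) = E.iCycles q z' →
        E.homologyπ q z = E.homologyπ q z' := by
    rintro E g ⟨H⟩ z z' hz
    rw [← hmap g z z' hz, H.homologyMap_eq q, HomologicalComplex.homologyMap_id]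
    rfl
  have hcomm : ∀ {E E' : ChainComplex AddCommGrpCat.{v} ℕ} (g : E ⟶ E') (i j : ℕ)
      (x : E.X i), E'.d i j (g.f i x) = g.f j (E.d i j x) := by
    intro E E' g i j x
    exact ConcreteCategory.congr_hom (g.comm i j) x
  rw [ConcreteCategory.isIso_iff_bijective]
  constructor
  · rw [injective_iff_map_eq_zero]
    intro a ha
    obtain ⟨z, rfl⟩ := hπs C a
    obtain ⟨z', hz'⟩ := hcyc D (f.f q (C.iCycles q z)) (by rw [hcomm, hid, map_zero])
    rw [hmap f z z' hz'.symm, hbd, hz'] at ha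
    obtain ⟨w, hw⟩ := ha
    -- With `f z = ∂w` and `f c = ψ w`, injectivity of `f` gives `φ z = ∂c`, and `φ z` is homologous
    -- to `z`.
    obtain ⟨φ, ψ, hφ, -, hcom, c, hc⟩ := h (q + 1) w
    have hφf : ∀ x, f.f q (φ.f q x) = ψ.f q (f.f q x) := fun x =>
      ConcreteCategory.congr_hom (HomologicalComplex.congr_hom hcom q) x
    obtain ⟨z'', hz''⟩ := hcyc C (φ.f q (C.iCycles q z)) (by rw [hcomm, hid, map_zero])
    rw [hone hφ z z'' hz''.symm, hbd]
    refine ⟨c, hinj q ?_⟩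
    rw [← hcomm, hc, hcomm, hw, hz'', hφf]
  · intro b
    obtain ⟨z, rfl⟩ := hπs D b
    -- The deformed cycle `ψ z = f c` is homologous to `z`, and `c` is a cycle because `f` is
    -- injective.
    obtain ⟨φ, ψ, -, hψ, hcom, c, hc⟩ := h q (D.iCycles q z)
    obtain ⟨z', hz'⟩ := hcyc C c (hinj _ (by rw [← hcomm, hc, hcomm, hid, map_zero, map_zero]))
    obtain ⟨z'', hz''⟩ := hcyc D (ψ.f q (D.iCycles q z)) (by rw [hcomm, hid, map_zero])
    refine ⟨C.homologyπ q z', ?_⟩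
    rw [hone hψ z z'' hz''.symm]
    exact hmap f z' z'' (by rw [hz', hz'', hc])

/-! ### Basins, absorption and limit points of orbits. -/

namespace Semiflow

variable {X : Type*} [MetricSpace X] {S : Semiflow X} {A K W : Set X}

theorem basin_forward {x : X} (hx : x ∈ S.basin A) (t : ℝ≥0) : S t x ∈ S.basin A := by
  have h : Tendsto (fun s : ℝ≥0 => s + t) atTop atTop :=
    tendsto_atTop_mono (fun s => le_self_add) tendsto_id
  refine (Tendsto.comp hx h).congr fun s => ?_
  rw [Function.comp_apply, Flow.map_add]

theorem basin_of_forward {x : X} {t : ℝ≥0} (hx : S t x ∈ S.basin A) : x ∈ S.basin A := by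
  have h : Tendsto (fun s : ℝ≥0 => s - t) atTop atTop := by
    refine tendsto_atTop.2 fun b => ?_
    filter_upwards [eventually_ge_atTop (b + t)] with s hs using le_tsub_of_add_le_right hs
  have h2 := Tendsto.comp hx h
  refine h2.congr' ?_
  filter_upwards [eventually_ge_atTop t] with s hs
  simp only [Function.comp_def]
  rw [← Flow.map_add, tsub_add_cancel_of_le hs]

theorem isInvariant_basin (S : Semiflow X) (A : Set X) : IsInvariant S (S.basin A) :=
  fun t _ hx => basin_forward hx t

/-- Orbits in the basin of a compact set enter every neighbourhood of that set. -/
theorem eventually_mem_of_mem_basin (hA : IsCompact A) (hW : W ∈ 𝓝ˢ A) {x : X}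
    (hx : x ∈ S.basin A) : ∀ᶠ t in atTop, S t x ∈ W := by
  obtain ⟨U, hU, hAU, hUW⟩ := mem_nhdsSet_iff_exists.1 hW
  obtain ⟨δ, hδ, hδU⟩ := hA.exists_thickening_subset_open hU hAU
  have : ∀ᶠ t in atTop, Metric.infEDist (S t x) A < ENNReal.ofReal δ :=
    Tendsto.eventually_lt_const (by simpa using hδ) hx
  filter_upwards [this] with t ht
  exact hUW (hδU ht)

/-- Compact subsets of the basin are absorbed by positively invariant neighbourhoods. -/
theorem exists_mapsTo_of_isCompact (hA : IsCompact A) (hW : W ∈ 𝓝ˢ A) (hWinv : IsInvariant S W)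
    {C : Set X} (hC : IsCompact C) (hCA : C ⊆ S.basin A) :
    ∃ T : ℝ≥0, ∀ t, T ≤ t → MapsTo (S t) C W := by
  refine hC.induction_on (p := fun C => ∃ T : ℝ≥0, ∀ t, T ≤ t → MapsTo (S t) C W)
    ⟨0, fun t _ => mapsTo_empty _ _⟩ ?_ ?_ ?_
  · rintro s t hst ⟨T, hT⟩
    exact ⟨T, fun r hr => (hT r hr).mono_left hst⟩
  · rintro s t ⟨T, hT⟩ ⟨T', hT'⟩
    exact ⟨max T T', fun r hr => (hT r (le_of_max_le_left hr)).union_union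
      (hT' r (le_of_max_le_right hr)) |>.mono_right (by simp)⟩
  · intro x hx
    have hI : interior W ∈ 𝓝ˢ A := by
      rw [mem_nhdsSet_iff_forall] at hW ⊢
      exact fun x hx => interior_mem_nhds.2 (hW x hx)
    obtain ⟨T, hT⟩ := (eventually_mem_of_mem_basin hA hI (hCA hx)).exists
    refine ⟨S T ⁻¹' interior W, mem_nhdsWithin_of_mem_nhds
      ((isOpen_interior.preimage (S.continuous_toFun T)).mem_nhds hT), T, fun t ht y hy => ?_⟩
    have := hWinv (t - T) (interior_subset hy)
    rwa [← Flow.map_add, tsub_add_cancel_of_le ht] at this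

namespace IsAttractor

theorem subset_basin (hK : S.IsAttractor K) : K ⊆ S.basin K := by
  intro x hx
  refine tendsto_const_nhds.congr fun t => ?_
  have : S t x ∈ K := hK.image_eq t ▸ mem_image_of_mem _ hx
  exact (Metric.infEDist_zero_of_mem this).symm

/-- The orbit of `x` enters the interior of an attracted neighbourhood at some time `T`; by
continuity of `S T` nearby points do too, and a point lies in the basin as soon as one forward image
does. -/
theorem isOpen_basin (hK : S.IsAttractor K) : IsOpen (S.basin K) := by
  obtain ⟨U, hU, hKU⟩ := hK.attracts
  have hUb : U ⊆ S.basin K := by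
    intro x hx
    refine ENNReal.tendsto_nhds_zero.2 fun ε hε => ?_
    by_cases hε' : ε = ⊤
    · simp [hε']
    obtain ⟨T, hT⟩ := hKU ε.toReal (ENNReal.toReal_pos hε.ne' hε')
    filter_upwards [eventually_gt_atTop T] with t ht
    have := hT t ht (mem_image_of_mem _ hx)
    rw [Metric.mem_thickening_iff_infEDist_lt, ENNReal.ofReal_toReal hε'] at this
    exact this.le
  rw [isOpen_iff_mem_nhds]
  intro x hx
  have hI : interior U ∈ 𝓝ˢ K := by
    rw [mem_nhdsSet_iff_forall] at hU ⊢
    exact fun x hx => interior_mem_nhds.2 (hU x hx)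
  obtain ⟨T, hT⟩ := (eventually_mem_of_mem_basin hK.isCompact hI hx).exists
  filter_upwards [(isOpen_interior.preimage (S.continuous_toFun T)).mem_nhds hT] with y hy
  exact basin_of_forward (hUb (interior_subset hy))

end IsAttractor

theorem IsAttractorIn.isCompact (h : S.IsAttractorIn K A) : IsCompact A := by
  obtain ⟨hAK, hK, hA⟩ := h
  have := hA.isCompact.image continuous_subtype_val
  rwa [Subtype.image_preimage_coe, inter_eq_right.2 hAK] at this

theorem IsAttractorIn.image_eq (h : S.IsAttractorIn K A) (t : ℝ≥0) : S t '' A = A := by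
  obtain ⟨hAK, hK, hA⟩ := h
  have hval : Subtype.val '' (Subtype.val ⁻¹' A : Set K) = A := by
    rw [Subtype.image_preimage_coe, inter_eq_right.2 hAK]
  calc S t '' A = Subtype.val '' (Flow.restrict S hK t '' (Subtype.val ⁻¹' A)) := by
        conv_lhs => rw [← hval]
        rw [image_image, image_image]
        rfl
    _ = A := by rw [hA.image_eq t, hval]

theorem IsAttractorIn.isInvariant (h : S.IsAttractorIn K A) : IsInvariant S A :=
  fun t _ hx => h.image_eq t ▸ mem_image_of_mem _ hx

/-- The orbit of a point of the basin of a compact set accumulates at that set. -/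
theorem exists_tendsto_of_mem_basin (hK : IsCompact K) {x : X} (hx : x ∈ S.basin K)
    {f : Ultrafilter ℝ≥0} (hf : ↑f ≤ (atTop : Filter ℝ≥0)) :
    ∃ y ∈ K, Tendsto (fun t => S t x) f (𝓝 y) := by
  have hKne : K.Nonempty := by
    by_contra! h
    subst h
    simp [basin] at hx
  -- Nearest points `p t` in `K` converge along `f` by compactness, and `S t x` has the same limit.
  choose p hpK hp using fun t => hK.exists_infEDist_eq_edist hKne (S t x)
  obtain ⟨y, hy, hle⟩ := hK.ultrafilter_le_nhds (f.map p)
    (le_principal_iff.2 (Filter.mem_map.2 (univ_mem' hpK)))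
  refine ⟨y, hy, ?_⟩
  have hpy : Tendsto p f (𝓝 y) := hle
  rw [tendsto_iff_edist_tendsto_0] at hpy ⊢
  have hx' : Tendsto (fun t => Metric.infEDist (S t x) K) f (𝓝 0) := Tendsto.mono_left hx hf
  refine tendsto_of_tendsto_of_tendsto_of_le_of_le tendsto_const_nhds
    (by simpa using hx'.add hpy) (fun _ => zero_le) fun t => ?_
  simp only [hp]
  exact edist_triangle _ _ _

theorem mem_omegaLimit_of_tendsto {x y : X} {f : Ultrafilter ℝ≥0}
    (hf : ↑f ≤ (atTop : Filter ℝ≥0)) (h : Tendsto (fun t => S t x) f (𝓝 y)) :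
    y ∈ omegaLimit atTop S {x} := by
  rw [mem_omegaLimit_singleton_iff_mapClusterPt]
  exact mapClusterPt_iff_ultrafilter.2 ⟨f, hf, h⟩

theorem tendsto_shift {x y : X} {f : Ultrafilter ℝ≥0}
    (h : Tendsto (fun t => S t x) f (𝓝 y)) (s : ℝ≥0) :
    Tendsto (fun t => S (s + t) x) f (𝓝 (S s y)) := by
  simp only [Flow.map_add]
  exact ((S.continuous_toFun s).tendsto y).comp h

theorem mem_basin_of_forall_tendsto {x : X}
    (h : ∀ f : Ultrafilter ℝ≥0, ↑f ≤ (atTop : Filter ℝ≥0) →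
      ∃ y ∈ A, Tendsto (fun t => S t x) f (𝓝 y)) : x ∈ S.basin A := by
  refine tendsto_iff_ultrafilter _ _ _ |>.2 fun f hf => ?_
  obtain ⟨y, hy, hty⟩ := h f hf
  have := (Metric.continuous_infEDist (s := A)).tendsto y |>.comp hty
  rwa [Metric.infEDist_zero_of_mem hy] at this

/-! ### Morse sets and sublevel sets of a Morse-Lyapunov function. -/

section Morse

variable {l : ℕ} {A : Fin (l + 1) → Set X}

theorem map_mem_morseSet (hA : S.IsMorseFiltration K A) {j : Fin l} {x : X}
    (hx : x ∈ S.morseSet K A j) (t : ℝ≥0) : S t x ∈ S.morseSet K A j := by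
  refine ⟨(hA.isAttractorIn _).isInvariant t hx.1, ?_, ?_⟩
  · have := (hA.isAttractorIn (Fin.last l)).isInvariant t (hA.last.symm ▸ hx.2.1)
    rwa [hA.last] at this
  · have h := Flow.omegaLimit_image_subset atTop S {x} t
      (tendsto_atTop_mono (fun _ => le_self_add) tendsto_id)
    rw [image_singleton] at h
    exact subset_empty_iff.1 ((inter_subset_inter_left _ h).trans hx.2.2.subset)

/-- An attractor of the filtration that meets a Morse set contains that Morse set. -/
theorem succ_le_of_mem_morseSet (hA : S.IsMorseFiltration K A) {j : Fin l} {m : Fin (l + 1)} {x : X}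
    (hx : x ∈ S.morseSet K A j) (hxm : x ∈ A m) : j.succ ≤ m := by
  by_contra! h
  have hle : m ≤ j.castSucc := by
    rw [Fin.le_def]; rw [Fin.lt_def] at h; simp at h ⊢; omega
  have hxj : ∀ t, S t x ∈ A j.castSucc := fun t =>
    hA.strictMono.monotone hle ((hA.isAttractorIn m).isInvariant t hxm)
  -- The orbit stays in the compact set `A j.castSucc`, so it has an ω-limit point there, which the
  -- dual repeller forbids.
  obtain ⟨y, hy, hle⟩ := (hA.isAttractorIn j.castSucc).isCompact.ultrafilter_le_nhds
    ((Ultrafilter.of (atTop : Filter ℝ≥0)).map fun t => S t x)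
    (le_principal_iff.2 (Filter.mem_map.2 (univ_mem' hxj)))
  exact (hx.2.2.subset ⟨mem_omegaLimit_of_tendsto (Ultrafilter.of_le _) hle, hy⟩)

variable {V : X → ℝ}

theorem IsMorseLyapunov.le (hA : S.IsMorseFiltration K A)
    (hV : S.IsMorseLyapunov K (S.morseSet K A) V) {x : X} (hx : x ∈ S.basin K) (t : ℝ≥0) :
    V (S t x) ≤ V x := by
  by_cases h : x ∈ ⋃ k, S.morseSet K A k
  · obtain ⟨j, hj⟩ := mem_iUnion.1 h
    exact (hV.const j _ (map_mem_morseSet hA hj t) _ hj).le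
  · rcases eq_or_ne t 0 with rfl | ht
    · simp
    · exact (hV.strictAnti x ⟨hx, h⟩ t (pos_iff_ne_zero.2 ht)).le

theorem IsMorseLyapunov.antitone (hA : S.IsMorseFiltration K A)
    (hV : S.IsMorseLyapunov K (S.morseSet K A) V) {x : X} (hx : x ∈ S.basin K) :
    Antitone fun t => V (S t x) := by
  intro s t hst
  have := hV.le hA (basin_forward hx s) (t - s)
  rwa [← Flow.map_add, tsub_add_cancel_of_le hst] at this

/-- Limit points of orbits in the basin lie in Morse sets. -/
theorem IsMorseLyapunov.exists_mem_morseSet_of_tendsto (hK : S.IsAttractor K)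
    (hA : S.IsMorseFiltration K A) (hV : S.IsMorseLyapunov K (S.morseSet K A) V) {x y : X}
    (hx : x ∈ S.basin K) (hy : y ∈ S.basin K) {f : Ultrafilter ℝ≥0}
    (hf : ↑f ≤ (atTop : Filter ℝ≥0)) (h : Tendsto (fun t => S t x) f (𝓝 y)) :
    V y ≤ V x ∧ ∃ j, y ∈ S.morseSet K A j := by
  have hcont : ∀ z ∈ S.basin K, ContinuousAt V z := fun z hz =>
    hV.continuousOn.continuousAt (hK.isOpen_basin.mem_nhds hz)
  have hVy : Tendsto (fun t => V (S t x)) f (𝓝 (V y)) := (hcont y hy).tendsto.comp h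
  have hanti := hV.antitone hA hx
  -- LaSalle's argument: monotonicity upgrades the ultrafilter limit to a full limit, so `V` is
  -- constant along the orbit of `y`.
  have hlim : Tendsto (fun t => V (S t x)) atTop (𝓝 (V y)) := by
    rcases tendsto_atTop_of_antitone hanti with hb | ⟨r, hr⟩
    · exact absurd hVy (not_tendsto_nhds_of_tendsto_atBot (hb.mono_left hf) _)
    · rwa [tendsto_nhds_unique hVy (hr.mono_left hf)]
  have hconst : ∀ s, V (S s y) = V y := fun s => by
    refine tendsto_nhds_unique ((hcont _ (basin_forward hy s)).tendsto.comp (tendsto_shift h s)) ?_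
    exact (hlim.comp (tendsto_atTop_mono (fun t => le_add_self) tendsto_id)).mono_left hf
  refine ⟨?_, ?_⟩
  · simpa using hanti.le_of_tendsto hlim 0
  · by_contra hne
    exact (hV.strictAnti y ⟨hy, by simpa using hne⟩ 1 one_pos).ne (hconst 1)

/-- On an attractor of the filtration, a Morse-Lyapunov function is bounded by its value at a point
of a Morse set that is contained in that attractor. -/
theorem IsMorseLyapunov.exists_isMaxOn (hK : S.IsAttractor K)
    (hA : S.IsMorseFiltration K A) (hV : S.IsMorseLyapunov K (S.morseSet K A) V)
    {m : Fin (l + 1)} (hm : (A m).Nonempty) :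
    ∃ j : Fin l, j.succ ≤ m ∧ ∃ y ∈ S.morseSet K A j, ∀ x ∈ A m, V x ≤ V y := by
  have hsub : A m ⊆ S.basin K := (hA.isAttractorIn m).1.trans hK.subset_basin
  obtain ⟨p, hp, hmax⟩ := (hA.isAttractorIn m).isCompact.exists_isMaxOn hm
    (hV.continuousOn.mono hsub)
  -- The maximum point is pulled back by time one: `V` cannot drop strictly from `y` to a maximum,
  -- so `y` is in a Morse set.
  obtain ⟨y, hy, rfl⟩ := ((hA.isAttractorIn m).image_eq 1).superset hp
  have hyM : ∃ j, y ∈ S.morseSet K A j := by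
    by_contra hne
    exact (hV.strictAnti y ⟨hsub hy, by simpa using hne⟩ 1 one_pos).not_ge (hmax hy)
  obtain ⟨j, hj⟩ := hyM
  exact ⟨j, succ_le_of_mem_morseSet hA hj hy, y, hj,
    fun x hx => (hmax hx).trans (hV.le hA (hsub hy) 1)⟩

theorem isInvariant_sublevel (hA : S.IsMorseFiltration K A)
    (hV : S.IsMorseLyapunov K (S.morseSet K A) V) (r : ℝ) : IsInvariant S (S.sublevel K V r) :=
  fun t _ hx => ⟨basin_forward hx.1 t, (hV.le hA hx.1 t).trans hx.2⟩

/-- `V` at a limit point of an orbit is at most its initial value, so only Morse sets at level at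
most `r` can be limits, and these lie in `A m`. -/
theorem sublevel_subset_basin (hK : S.IsAttractor K) (hA : S.IsMorseFiltration K A)
    (hV : S.IsMorseLyapunov K (S.morseSet K A) V) {r : ℝ} {m : Fin (l + 1)}
    (hr : ∀ j, ∀ y ∈ S.morseSet K A j, V y ≤ r → j.succ ≤ m) :
    S.sublevel K V r ⊆ S.basin (A m) := by
  intro x hx
  refine mem_basin_of_forall_tendsto fun f hf => ?_
  obtain ⟨y, hyK, hy⟩ := exists_tendsto_of_mem_basin hK.isCompact hx.1 hf
  obtain ⟨hyx, j, hj⟩ :=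
    hV.exists_mem_morseSet_of_tendsto hK hA hx.1 (hK.subset_basin hyK) hf hy
  exact ⟨y, hA.strictMono.monotone (hr j y hj (hyx.trans hx.2)) hj.1, hy⟩

theorem sublevel_mem_nhdsSet (hK : S.IsAttractor K) (hA : S.IsMorseFiltration K A)
    (hV : S.IsMorseLyapunov K (S.morseSet K A) V) {r : ℝ} {m : Fin (l + 1)}
    (hr : ∀ j : Fin l, j.succ ≤ m → ∀ y ∈ S.morseSet K A j, V y < r) :
    S.sublevel K V r ∈ 𝓝ˢ (A m) := by
  rw [mem_nhdsSet_iff_forall]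
  intro x hx
  have hxb : S.basin K ∈ 𝓝 x :=
    hK.isOpen_basin.mem_nhds (hK.subset_basin ((hA.isAttractorIn m).1 hx))
  obtain ⟨j, hjm, y, hy, hmax⟩ := hV.exists_isMaxOn hK hA ⟨x, hx⟩
  filter_upwards [hxb, (hV.continuousOn.continuousAt hxb).eventually_lt_const
    ((hmax x hx).trans_lt (hr j hjm y hy))] with z hz hz' using ⟨hz, hz'.le⟩

end Morse

end Semiflow

/-! ### Absorption of singular chains by the semiflow. -/

namespace Semiflow

variable {X : Type u} [MetricSpace X] (S : Semiflow X)

/-- The time-`t` map of a semiflow on a positively invariant set. -/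
def timeMap {W : Set X} (hW : IsInvariant S W) (t : ℝ≥0) : TopCat.of W ⟶ TopCat.of W :=
  TopCat.ofHom ⟨Flow.restrict S hW t, (Flow.restrict S hW).continuous_toFun t⟩

/-- The time-`t` map of a semiflow is homotopic to the identity. -/
def timeMapHomotopy {W : Set X} (hW : IsInvariant S W) (t : ℝ≥0) :
    TopCat.Homotopy (𝟙 (TopCat.of W)) (timeMap S hW t) where
  toFun p := Flow.restrict S hW (unitInterval.toNNReal p.1 * t) p.2
  continuous_toFun := (Flow.restrict S hW).continuous (by fun_prop) continuous_snd
  map_zero_left x := by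
    change Flow.restrict S hW (unitInterval.toNNReal 0 * t) x = x
    simp
  map_one_left x := by
    change Flow.restrict S hW (unitInterval.toNNReal 1 * t) x = Flow.restrict S hW t x
    simp

variable {S}

/-- The singular chain complex of a space with coefficients in `G`. -/
noncomputable abbrev singularChains (G : Type v) [AddCommGroup G] :
    TopCat.{u} ⥤ ChainComplex AddCommGrpCat.{max u v} ℕ :=
  (singularChainComplexFunctor AddCommGrpCat.{max u v}).obj (AddCommGrpCat.of (ULift.{u} G))

instance mono_inclusionTop {A B : Set X} (h : A ⊆ B) : Mono (inclusionTop h) :=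
  (TopCat.mono_iff_injective _).2 (Set.inclusion_injective h)

theorem timeMap_inclusion {A B : Set X} (h : A ⊆ B) (hA : IsInvariant S A) (hB : IsInvariant S B)
    (t : ℝ≥0) : timeMap S hA t ≫ inclusionTop h = inclusionTop h ≫ timeMap S hB t := rfl

/-- If compact subsets of `B` are absorbed by `A ⊆ B`, then all chains of `B` are. -/
theorem exists_chain_eq (G : Type v) [AddCommGroup G] {A B : Set X} (h : A ⊆ B)
    (hB : IsInvariant S B)
    (habs : ∀ C ⊆ B, IsCompact C → ∃ T : ℝ≥0, ∀ t, T ≤ t → MapsTo (S t) C A) {q : ℕ}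
    (d : ((singularChains G).obj (TopCat.of B)).X q) :
    ∃ T : ℝ≥0, ∀ t, T ≤ t → ∃ c, ((singularChains G).map (inclusionTop h)).f q c =
      ((singularChains G).map (timeMap S hB t)).f q d := by
  let R := AddCommGrpCat.of (ULift.{u} G)
  -- Requiring every `t ≥ T`, not just one time, makes the condition additive: the later of two
  -- thresholds serves both chains.
  let H : AddSubgroup (((singularChains G).obj (TopCat.of B)).X q) :=
    { carrier := {d | ∃ T : ℝ≥0, ∀ t, T ≤ t →
        ∃ c, ((singularChains G).map (inclusionTop h)).f q c =
          ((singularChains G).map (timeMap S hB t)).f q d}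
      zero_mem' := ⟨0, fun t _ => ⟨0, by rw [map_zero, map_zero]⟩⟩
      add_mem' := by
        rintro d d' ⟨T, hT⟩ ⟨T', hT'⟩
        refine ⟨max T T', fun t ht => ?_⟩
        obtain ⟨c, hc⟩ := hT t (le_of_max_le_left ht)
        obtain ⟨c', hc'⟩ := hT' t (le_of_max_le_right ht)
        exact ⟨c + c', by rw [map_add, map_add, hc, hc']⟩
      neg_mem' := by
        rintro d ⟨T, hT⟩
        refine ⟨T, fun t ht => ?_⟩
        obtain ⟨c, hc⟩ := hT t ht
        exact ⟨-c, by rw [map_neg, map_neg, hc]⟩ }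
  refine AddCommGrpCat.cofan_induction (SSet.isColimitChainComplexXCofan
    (TopCat.toSSet.obj (TopCat.of B)) R q) H (fun σ g => ?_) d
  have hι : ∀ {Y Z : TopCat.{u}} (f : Y ⟶ Z) (τ : (TopCat.toSSet.obj Y).obj (Opposite.op (.mk q))),
      ((singularChains G).map f).f q ((TopCat.toSSet.obj Y).ιChainComplex (R := R) τ g) =
      (TopCat.toSSet.obj Z).ιChainComplex (R := R) ((TopCat.toSSet.map f).app _ τ) g := fun f τ =>
    ConcreteCategory.congr_hom (SSet.ι_chainComplexMap_f _ _ (TopCat.toSSet.map f) R τ) g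
  let s : C(ULift.{u} (stdSimplex ℝ (Fin (q + 1))), B) := σ.down.hom
  obtain ⟨T, hT⟩ := habs (range fun x => (s x : X)) (range_subset_iff.2 fun x => (s x).2)
    (isCompact_range (by fun_prop))
  refine ⟨T, fun t ht => ?_⟩
  -- The simplex `S t ∘ σ`, with values now in `A`.
  let τ : (TopCat.toSSet.obj (TopCat.of A)).obj (Opposite.op (.mk q)) :=
    ⟨TopCat.ofHom ⟨fun x => (⟨S t (s x), hT t ht (mem_range_self x)⟩ : A), by
      refine Continuous.subtype_mk ?_ _
      exact (S.continuous_toFun t).comp (by fun_prop)⟩⟩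
  refine ⟨(TopCat.toSSet.obj (TopCat.of A)).ιChainComplex (R := R) τ g, ?_⟩
  refine (hι (inclusionTop h) τ).trans (Eq.trans ?_ (hι (timeMap S hB t) σ).symm)
  rfl

/-- The absorption time depends on the chain, so no single time map need carry `B` into `A`; hence a
criterion that deforms one chain at a time. -/
theorem quasiIso_inclusion (G : Type v) [AddCommGroup G] {A B : Set X} (h : A ⊆ B)
    (hA : IsInvariant S A) (hB : IsInvariant S B)
    (habs : ∀ C ⊆ B, IsCompact C → ∃ T : ℝ≥0, ∀ t, T ≤ t → MapsTo (S t) C A) :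
    QuasiIso ((singularChains G).map (inclusionTop h)) := by
  refine AddCommGrpCat.quasiIso_of_deformation _ fun q d => ?_
  obtain ⟨T, hT⟩ := exists_chain_eq G h hB habs d
  obtain ⟨c, hc⟩ := hT T le_rfl
  refine ⟨(singularChains G).map (timeMap S hA T), (singularChains G).map (timeMap S hB T),
    ⟨?_⟩, ⟨?_⟩, ?_, c, hc⟩
  · rw [← (singularChains G).map_id]
    exact ((timeMapHomotopy S hA T).singularChainComplexFunctorObjMap _).symm
  · rw [← (singularChains G).map_id]
    exact ((timeMapHomotopy S hB T).singularChainComplexFunctorObjMap _).symm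
  · rw [← Functor.map_comp, ← Functor.map_comp, timeMap_inclusion]

end Semiflow

/-! ### Relative homology and comparison with the basins. -/

/-- A map of pairs given by inclusions that induces isomorphisms in absolute homology does so in
relative homology. -/
theorem nonempty_relativeSingularHomology_iso {X : Type u} [MetricSpace X] (G : Type v)
    [AddCommGroup G] {A B A' B' : Set X} (hAB : A ⊆ B) (hAB' : A' ⊆ B') (hA : A ⊆ A') (hB : B ⊆ B')
    (h₁ : QuasiIso ((Semiflow.singularChains G).map (inclusionTop hA)))
    (h₂ : QuasiIso ((Semiflow.singularChains G).map (inclusionTop hB))) (q : ℕ) :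
    Nonempty (relativeSingularHomology G hAB q ≅ relativeSingularHomology G hAB' q) := by
  let F := Semiflow.singularChains.{u, v} G
  have hcomm : F.map (inclusionTop hA) ≫ F.map (inclusionTop hAB') =
      F.map (inclusionTop hAB) ≫ F.map (inclusionTop hB) := by
    rw [← F.map_comp, ← F.map_comp]; rfl
  let S₁ := ShortComplex.mk (F.map (inclusionTop hAB)) (cokernel.π _) (cokernel.condition _)
  let S₂ := ShortComplex.mk (F.map (inclusionTop hAB')) (cokernel.π _) (cokernel.condition _)
  have hS₁ : S₁.ShortExact :=
    { exact := ShortComplex.exact_of_g_is_cokernel _ (cokernelIsCokernel _)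
      mono_f := inferInstanceAs (Mono (F.map (inclusionTop hAB)))
      epi_g := inferInstanceAs (Epi (cokernel.π _)) }
  have hS₂ : S₂.ShortExact :=
    { exact := ShortComplex.exact_of_g_is_cokernel _ (cokernelIsCokernel _)
      mono_f := inferInstanceAs (Mono (F.map (inclusionTop hAB')))
      epi_g := inferInstanceAs (Epi (cokernel.π _)) }
  let φ : S₁ ⟶ S₂ :=
    { τ₁ := F.map (inclusionTop hA)
      τ₂ := F.map (inclusionTop hB)
      τ₃ := cokernel.map _ _ _ _ hcomm.symm
      comm₁₂ := hcomm
      comm₂₃ := (cokernel.π_desc _ _ _).symm }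
  -- The five lemma on the long exact homology sequences.
  have : QuasiIso φ.τ₃ := HomologicalComplex.HomologySequence.quasiIso_τ₃ φ hS₁ hS₂ h₁ h₂
  have : IsIso (HomologicalComplex.homologyMap φ.τ₃ q) :=
    (quasiIsoAt_iff_isIso_homologyMap _ _).1 inferInstance
  exact ⟨@asIso _ _ _ _ _ this⟩

namespace Semiflow

/-- The relative homology of positively invariant neighbourhoods of compact sets, contained in their
basins, is that of the basins. -/
theorem nonempty_relativeSingularHomology_iso_basin {X : Type u} [MetricSpace X] {S : Semiflow X}
    (G : Type v) [AddCommGroup G] {A A' W W' : Set X} (hA : IsCompact A) (hA' : IsCompact A')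
    (hW : W ∈ 𝓝ˢ A) (hW' : W' ∈ 𝓝ˢ A') (hWinv : IsInvariant S W) (hWinv' : IsInvariant S W')
    (hWb : W ⊆ S.basin A) (hWb' : W' ⊆ S.basin A') (hWW' : W' ⊆ W)
    (hb : S.basin A' ⊆ S.basin A) (q : ℕ) :
    Nonempty (relativeSingularHomology G hWW' q ≅ relativeSingularHomology G hb q) :=
  nonempty_relativeSingularHomology_iso G hWW' hb hWb' hWb
    (quasiIso_inclusion G hWb' hWinv' (isInvariant_basin S A') fun _ hC hCc =>
      exists_mapsTo_of_isCompact hA' hW' hWinv' hCc hC)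
    (quasiIso_inclusion G hWb hWinv (isInvariant_basin S A) fun _ hC hCc =>
      exists_mapsTo_of_isCompact hA hW hWinv hCc hC) q

theorem basin_mono {X : Type*} [MetricSpace X] {S : Semiflow X} {A B : Set X} (h : A ⊆ B) :
    S.basin A ⊆ S.basin B := fun _ hx =>
  tendsto_of_tendsto_of_tendsto_of_le_of_le tendsto_const_nhds hx (fun _ => zero_le)
    fun _ => Metric.infEDist_anti h

end Semiflow

/-! ### The critical groups. -/

theorem theoremt {X : Type u} [MetricSpace X] [CompleteSpace X]
    (G : Type v) [AddCommGroup G]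
    (S : Semiflow X) (hS : S.AsymptoticallyCompact)
    (K : Set X) (hK : S.IsAttractor K)
    (l : ℕ) (A : Fin (l + 1) → Set X) (hA : S.IsMorseFiltration K A)
    (V : X → ℝ) (hV : S.IsStrictMorseLyapunov K (S.morseSet K A) V)
    (k : Fin l) (a b : ℝ) (hab : a < b)
    (hk : Semiflow.IsolatesCriticalValue (S.morseSet K A) V k a b)
    (W W' : Set X) (hW : W ∈ 𝓝ˢ (A k.succ)) (hW' : W' ∈ 𝓝ˢ (A k.castSucc))
    (hWinv : IsInvariant S W) (hWinv' : IsInvariant S W')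
    (hWbasin : W ⊆ S.basin (A k.succ)) (hWbasin' : W' ⊆ S.basin (A k.castSucc))
    (hWW' : W' ⊆ W) (q : ℕ) :
    Nonempty (S.criticalGroup K G V hab q ≅ relativeSingularHomology G hWW' q) := by
  obtain ⟨c, hc, hac, hcb, hiso⟩ := hk
  have hL := hV.toIsMorseLyapunov
  obtain ⟨p, hp, rfl⟩ : c ∈ V '' S.morseSet K A k := hc ▸ rfl
  -- Isolation of `V p` in `[a, b]` and the ordering of the critical values put lower Morse sets
  -- below `a` and higher ones above `b`.
  have hlt : ∀ j, ∀ y ∈ S.morseSet K A j, j < k → V y < a := by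
    intro j y hy hj
    by_contra! hya
    have hyc := hV.lt j k hj y hy p hp
    exact hyc.ne (hiso.subset ⟨mem_iUnion.2 ⟨j, y, hy, rfl⟩, hya, (hyc.trans hcb).le⟩)
  have hgt : ∀ j, ∀ y ∈ S.morseSet K A j, k < j → b < V y := by
    intro j y hy hj
    by_contra! hyb
    have hyc := hV.lt k j hj p hp y hy
    exact hyc.ne' (hiso.subset ⟨mem_iUnion.2 ⟨j, y, hy, rfl⟩, (hac.trans hyc).le, hyb⟩)
  have hkeq : ∀ y ∈ S.morseSet K A k, V y = V p := fun y hy => hV.const k y hy p hp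
  have hcpt := fun m => (hA.isAttractorIn m).isCompact
  have hmono := Semiflow.basin_mono (S := S) (hA.strictMono.monotone k.castSucc_lt_succ.le)
  obtain ⟨e₁⟩ := Semiflow.nonempty_relativeSingularHomology_iso_basin (S := S) G (hcpt k.succ)
    (hcpt k.castSucc) hW hW' hWinv hWinv' hWbasin hWbasin' hWW' hmono q
  obtain ⟨e₂⟩ := Semiflow.nonempty_relativeSingularHomology_iso_basin (S := S) G (hcpt k.succ)
    (hcpt k.castSucc)
    (Semiflow.sublevel_mem_nhdsSet (r := b) hK hA hL fun j hj y hy => by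
      rcases (Fin.succ_le_succ_iff.1 hj).lt_or_eq with hj | rfl
      · exact (hlt j y hy hj).trans hab
      · exact (hkeq y hy).trans_lt hcb)
    (Semiflow.sublevel_mem_nhdsSet (r := a) hK hA hL fun j hj y hy =>
      hlt j y hy (Fin.succ_le_castSucc_iff.1 hj))
    (Semiflow.isInvariant_sublevel hA hL b) (Semiflow.isInvariant_sublevel hA hL a)
    (Semiflow.sublevel_subset_basin hK hA hL fun j y hy hyb =>
      Fin.succ_le_succ_iff.2 (not_lt.1 fun hj => (hgt j y hy hj).not_ge hyb))
    (Semiflow.sublevel_subset_basin hK hA hL fun j y hy hya => by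
      refine Fin.succ_le_castSucc_iff.2 (not_le.1 fun hj => hya.not_gt ?_)
      rcases hj.lt_or_eq with hj | rfl
      · exact hab.trans (hgt j y hy hj)
      · exact hac.trans_eq (hkeq y hy).symm)
    (S.sublevel_mono K V hab.le) hmono q
  exact ⟨e₂ ≪≫ e₁.symm⟩
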